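/- A quandle is a set $X$ with a binary operation $\lhd$ such that $(a\lhd b)\lhd c=(a\lhd c)\lhd(b\lhd c)$, every right translation $-\lhd b$ is bijective, and $a\lhd a=a$. It is abelian if $(a\lhd b)\lhd c=(a\lhd c)\lhd b$ for all $a,b,c$. Let $H_2(X)=\ker d_2/\operatorname{im} d_3$ be its second (rack) homology group, where $d_2\colon\mathbb{Z}X^2\to\mathbb{Z}X$ and $d_3\colon\mathbb{Z}X^3\to\mathbb{Z}X^2$ are the linear maps with $d_2(a,b)=(a\lhd b)-(a)$ and $d_3(a,b,c)=(a\lhd b,c)-(a,c)-(a\lhd c,b\lhd c)+(a,b)$. Put $Q_2(X)=\mathbb{Z}X^2/\operatorname{im} d_3\supseteq H_2(X)$. Let $G(X)=\langle g_a,\ a\in X\mid g_ag_b=g_bg_{a\lhd b}\rangle$ be the structure group; it acts on $X$ on the right by $a\cdot g_b=a\lhd b$. For $a\in X$, the path map $p_a\colon G(X)\to Q_2(X)$ is the map determined by $p_a(g_b)=[(a,b)]$ and $p_a(gh)=p_a(g)+p_{a\cdot g}(h)$ for all $a,b\in X$, $g,h\in G(X)$. If $X$ is a finite abelian quandle with orbits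 $O_1,\dots,O_r$, its torsion group $T_i\subseteq H_2(X)$ is the image under $p_a$, for any $a\in O_i$, of the commutator subgroup $[G(X),G(X)]$. For integers $m,n\ge 1$, let $U_{m,n}=\{x_0,\dots,x_{m-1},y_0,\dots,y_{n-1}\}$ be the abelian quandle with operation $$x_i\lhd x_j=x_i,\qquad y_k\lhd y_l=y_k,\qquad x_i\lhd y_k=x_{i+1},\qquad y_k\lhd x_i=y_{k+1},$$ indices of $x$ being taken modulo $m$ and those of $y$ modulo $n$. It has two orbits, $O_1=\{x_0,\dots,x_{m-1}\}$ and $O_2=\{y_0,\dots,y_{n-1}\}$. Its parameter group $G'$ is the quotient of the product $\langle x\mid x^m\rangle\times\langle y\mid y^n\rangle$ of two cyclic groups by the subgroup generated by $xy$. **Proposition.** For all integers $m,n\ge 1$, $$H_2(U_{m,n})\cong\mathbb{Z}^4\oplus(\mathbb{Z}_{\gcd(m,n)})^2 .$$ Both torsion groups coincide with the whole parameter group: $T_1\cong T_2\cong G'\cong\mathbb{Z}_{\gcd(m,n)}$, and for every $a\in U_{m,n}$ the path map $p_a$ is injective on the commutator subgroup of $G(U_{m,n})$. -/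

import Mathlib

namespace QuandleHomology

/-! ### Quandles, written with right translations

Mathlib's `Quandle` is used throughout.  Mathlib writes `b ◃ a` for the element obtained by letting
`b` act on `a`; here this element is written `a ◁ b`, so that `- ◁ b` is the right translation by
`b`, and Mathlib's axioms become `(a ◁ b) ◁ c = (a ◁ c) ◁ (b ◁ c)`, bijectivity of `- ◁ b`,
and `a ◁ a = a`. -/

/-- The right-handed quandle operation `a ◁ b`. -/
def rop {X : Type*} [Shelf X] (a b : X) : X := Shelf.act b a

infixl:67 " ◁ " => rop

section General

variable (X : Type*)

theorem rop_distrib {X : Type*} [Shelf X] (a b c : X) :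
    a ◁ b ◁ c = (a ◁ c) ◁ (b ◁ c) :=
  Shelf.self_distrib

/-- The right translation `- ◁ b`, as a permutation. -/
def rtrans {X : Type*} [Rack X] (b : X) : Equiv.Perm X := Rack.act' b

theorem rtrans_apply {X : Type*} [Rack X] (a b : X) : rtrans b a = a ◁ b := rfl

/-- A quandle is abelian if `(a ◁ b) ◁ c = (a ◁ c) ◁ b` for all `a, b, c`. -/
class IsAbelianQuandle (X : Type*) [Quandle X] : Prop where
  rop_right_comm : ∀ a b c : X, a ◁ b ◁ c = a ◁ c ◁ b

/-! ### Rack homology -/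

/-- The chain group `C_k(X) = ℤ X^k`. -/
abbrev Chain (k : ℕ) : Type _ := (Fin k → X) →₀ ℤ

/-- The boundary of a generator `(a_0, …, a_k)` (numbered from `0`): the sum over `1 ≤ i ≤ k` of
`(-1)^i [(a_0, …, â_i, …, a_k) - (a_0 ◁ a_i, …, a_{i-1} ◁ a_i, a_{i+1}, …, a_k)]`. -/
noncomputable def boundaryGen {X : Type*} [Shelf X] {k : ℕ} (a : Fin (k + 1) → X) : Chain X k :=
  ∑ i : Fin k, (-1 : ℤ) ^ (i.val + 1) •
    (Finsupp.single (i.succ.removeNth a) 1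
      - Finsupp.single (i.succ.removeNth fun j => if j < i.succ then a j ◁ a i.succ else a j) 1)

/-- The differential `d_{k+1} : C_{k+1}(X) → C_k(X)` of the rack chain complex. -/
noncomputable def boundary [Shelf X] (k : ℕ) : Chain X (k + 1) →ₗ[ℤ] Chain X k :=
  Finsupp.linearCombination ℤ boundaryGen

theorem boundary_two {X : Type*} [Shelf X] (a b : X) :
    boundary X 1 (Finsupp.single ![a, b] 1)
      = Finsupp.single ![a ◁ b] 1 - Finsupp.single ![a] 1 := by
  have h1 : ((1 : Fin 2).removeNth ![a, b]) = ![a] := by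
    funext j; fin_cases j; rfl
  have h2 : ((1 : Fin 2).removeNth fun j => if j = 0 then (![a, b] : Fin 2 → X) j ◁ b
      else (![a, b] : Fin 2 → X) j) = ![a ◁ b] := by
    funext j; fin_cases j; rfl
  simp [boundary, boundaryGen, h1, h2]

theorem boundary_three {X : Type*} [Shelf X] (a b c : X) :
    boundary X 2 (Finsupp.single ![a, b, c] 1)
      = Finsupp.single ![a ◁ b, c] 1 - Finsupp.single ![a, c] 1
        - Finsupp.single ![a ◁ c, b ◁ c] 1 + Finsupp.single ![a, b] 1 := by
  have h1 : ((1 : Fin 3).removeNth ![a, b, c]) = ![a, c] := by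
    funext j; fin_cases j <;> rfl
  have h2 : ((1 : Fin 3).removeNth fun j => if j = 0 then (![a, b, c] : Fin 3 → X) j ◁ b
      else (![a, b, c] : Fin 3 → X) j) = ![a ◁ b, c] := by
    funext j; fin_cases j <;> rfl
  have h3 : ((2 : Fin 3).removeNth ![a, b, c]) = ![a, b] := by
    funext j; fin_cases j <;> rfl
  have h4 : ((2 : Fin 3).removeNth fun j => if j < 2 then (![a, b, c] : Fin 3 → X) j ◁ c
      else (![a, b, c] : Fin 3 → X) j) = ![a ◁ c, b ◁ c] := by
    funext j; fin_cases j <;> rfl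
  simp [boundary, boundaryGen, Fin.sum_univ_two, h1, h2, h3, h4]
  abel

theorem boundary_boundary [Shelf X] : boundary X 1 ∘ₗ boundary X 2 = 0 := by
  apply Finsupp.lhom_ext'
  intro v
  apply LinearMap.ext_ring
  obtain ⟨a, b, c, rfl⟩ : ∃ a b c, v = ![a, b, c] :=
    ⟨v 0, v 1, v 2, by funext j; fin_cases j <;> rfl⟩
  have h := congrArg (boundary X 1) (boundary_three a b c)
  simp only [map_add, map_sub, boundary_two, rop_distrib a b c] at h
  change boundary X 1 (boundary X 2 (Finsupp.single ![a, b, c] 1)) = 0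
  rw [h]
  abel

/-- The second (rack) homology group `H_2(X) = Z_2 / B_2`, where `Z_2 = ker d_2` and
`B_2 = im d_3`. -/
abbrev H2 [Shelf X] : Type _ :=
  LinearMap.ker (boundary X 1) ⧸
    (LinearMap.range (boundary X 2)).submoduleOf (LinearMap.ker (boundary X 1))

/-- The group `Q_2(X) = C_2 / B_2`. -/
abbrev Q2 [Shelf X] : Type _ := Chain X 2 ⧸ LinearMap.range (boundary X 2)

/-- The inclusion `H_2 = Z_2 / B_2 ↪ C_2 / B_2 = Q_2`. -/
noncomputable def H2toQ2 [Shelf X] : H2 X →ₗ[ℤ] Q2 X :=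
  Submodule.mapQ _ _ (LinearMap.ker (boundary X 1)).subtype le_rfl

theorem H2toQ2_injective [Shelf X] : Function.Injective (H2toQ2 X) := by
  rw [injective_iff_map_eq_zero]
  intro z hz
  obtain ⟨z, rfl⟩ := Submodule.Quotient.mk_surjective _ z
  rw [Submodule.Quotient.mk_eq_zero]
  exact (Submodule.Quotient.mk_eq_zero (LinearMap.range (boundary X 2))).1 hz

/-! ### The structure group and the path maps -/

/-- The structure group `⟨g_a, a ∈ X | g_a g_b = g_b g_{a ◁ b}⟩`. -/
abbrev StructureGroup [Shelf X] : Type _ :=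
  PresentedGroup (Set.range fun p : X × X =>
    FreeGroup.of p.1 * FreeGroup.of p.2 * (FreeGroup.of p.2 * FreeGroup.of (p.1 ◁ p.2))⁻¹)

/-- The generator `g_a` of the structure group. -/
def StructureGroup.gen {X : Type*} [Shelf X] (a : X) : StructureGroup X := PresentedGroup.of a

variable {X}

/-- The class in `Q_2(X)` of the generator `(a, b)`, thought of as an edge `a → a ◁ b`
labelled by `b`. -/
noncomputable def edge [Shelf X] (a b : X) : Q2 X :=
  Submodule.Quotient.mk (Finsupp.single ![a, b] 1)

theorem edge_square [Shelf X] (a b c : X) :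
    edge a b + edge (a ◁ b) c = edge a c + edge (a ◁ c) (b ◁ c) := by
  have h : (Submodule.Quotient.mk (boundary X 2 (Finsupp.single ![a, b, c] 1)) : Q2 X) = 0 :=
    (Submodule.Quotient.mk_eq_zero _).2 ⟨_, rfl⟩
  rw [boundary_three] at h
  simp only [Submodule.Quotient.mk_add, Submodule.Quotient.mk_sub] at h
  rw [← sub_eq_zero, ← h]
  simp only [edge]
  abel

/-- Following the edge labelled by `b`: `(a, q) ↦ (a ◁ b, q + (a, b))`.  The inverse travels the
edge labelled by `b` that ends in the current vertex backwards. -/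
noncomputable def step [Rack X] (b : X) : Equiv.Perm (X × Q2 X) where
  toFun p := (p.1 ◁ b, p.2 + edge p.1 b)
  invFun p := ((rtrans b).symm p.1, p.2 - edge ((rtrans b).symm p.1) b)
  left_inv p := by
    have h : (rtrans b).symm (p.1 ◁ b) = p.1 := (rtrans b).symm_apply_apply p.1
    simp [h]
  right_inv p := by
    have h : ((rtrans b).symm p.1) ◁ b = p.1 := (rtrans b).apply_symm_apply p.1
    simp [h]

/-- Following a path whose edges are labelled, from left to right, by the letters of a word that
represents an element of the structure group; inverse letters are travelled backwards.  The first
component is the current vertex, the second one accumulates the edges with their signs. -/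
noncomputable def follow [Rack X] : StructureGroup X →* (Equiv.Perm (X × Q2 X))ᵐᵒᵖ :=
  PresentedGroup.toGroup (f := fun b => MulOpposite.op (step b)) (by
    rintro _ ⟨⟨b, c⟩, rfl⟩
    simp only [map_mul, map_inv, FreeGroup.lift_apply_of]
    rw [mul_inv_eq_one]
    simp only [← MulOpposite.op_mul]
    congr 1
    ext1 ⟨a, q⟩
    simp only [Equiv.Perm.mul_apply, step, Equiv.coe_fn_mk, rop_distrib a b c, add_assoc,
      edge_square a b c])

/-- The (right) action of the structure group on `X`, characterised by `a · g_b = a ◁ b`: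
the end of the path that starts in `a`. -/
noncomputable def endpoint [Rack X] (a : X) (g : StructureGroup X) : X :=
  ((follow g).unop (a, 0)).1

/-- The path map `p_a : G(X) → Q_2(X)`: the sum of the (signed) edges of the path
that starts in `a`. -/
noncomputable def pathMap [Rack X] (a : X) (g : StructureGroup X) : Q2 X :=
  ((follow g).unop (a, 0)).2

theorem follow_gen [Rack X] (b : X) : (follow (StructureGroup.gen b)).unop = step b := by
  simp [follow, StructureGroup.gen]

theorem StructureGroup.induction [Rack X] {P : StructureGroup X → Prop} (h1 : P 1)
    (hgen : ∀ g b, P g → P (g * StructureGroup.gen b))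
    (hinv : ∀ g b, P g → P (g * (StructureGroup.gen b)⁻¹)) (g : StructureGroup X) : P g := by
  have hg : g ∈ Subgroup.closure (Set.range (StructureGroup.gen (X := X))) := by
    have := PresentedGroup.closure_range_of (Set.range fun p : X × X =>
      FreeGroup.of p.1 * FreeGroup.of p.2 * (FreeGroup.of p.2 * FreeGroup.of (p.1 ◁ p.2))⁻¹)
    change g ∈ Subgroup.closure (Set.range _)
    erw [this]
    trivial
  induction hg using Subgroup.closure_induction_right with
  | one => exact h1
  | mul_right x _ y hy ih => obtain ⟨b, rfl⟩ := hy; exact hgen x b ih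
  | mul_inv_cancel x _ y hy ih => obtain ⟨b, rfl⟩ := hy; exact hinv x b ih

theorem follow_eq [Rack X] (a : X) (q : Q2 X) (g : StructureGroup X) :
    (follow g).unop (a, q) = (endpoint a g, q + pathMap a g) := by
  induction g using StructureGroup.induction generalizing a q with
  | h1 => simp [endpoint, pathMap]
  | hgen g b ih =>
    have h := ih a 0
    simp only [endpoint, pathMap, map_mul, MulOpposite.unop_mul, Equiv.Perm.mul_apply, follow_gen]
    rw [ih a q, ih a 0]
    simp [step, add_assoc]
  | hinv g b ih =>
    simp only [endpoint, pathMap, map_mul, map_inv, MulOpposite.unop_mul, MulOpposite.unop_inv,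
      Equiv.Perm.mul_apply, follow_gen]
    rw [ih a q, ih a 0]
    simp [step, Equiv.Perm.inv_def, add_sub_assoc]

theorem endpoint_mul [Rack X] (a : X) (g h : StructureGroup X) :
    endpoint a (g * h) = endpoint (endpoint a g) h := by
  have := follow_eq a 0 (g * h)
  rw [map_mul, MulOpposite.unop_mul, Equiv.Perm.mul_apply, follow_eq, follow_eq] at this
  exact (congrArg Prod.fst this).symm

/-- Path maps are group `1`-cocycles. -/
theorem pathMap_mul [Rack X] (a : X) (g h : StructureGroup X) :
    pathMap a (g * h) = pathMap a g + pathMap (endpoint a g) h := by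
  have := follow_eq a 0 (g * h)
  rw [map_mul, MulOpposite.unop_mul, Equiv.Perm.mul_apply, follow_eq, follow_eq] at this
  simpa using (congrArg Prod.snd this).symm

theorem endpoint_one [Rack X] (a : X) : endpoint a 1 = a := by simp [endpoint]

theorem pathMap_one [Rack X] (a : X) : pathMap a 1 = 0 := by simp [pathMap]

theorem endpoint_gen [Rack X] (a b : X) : endpoint a (StructureGroup.gen b) = a ◁ b := by
  simp [endpoint, follow_gen, step]

theorem pathMap_gen [Rack X] (a b : X) : pathMap a (StructureGroup.gen b) = edge a b := by
  simp [pathMap, follow_gen, step]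

theorem endpoint_inv_gen [Rack X] (a b : X) :
    endpoint a (StructureGroup.gen b)⁻¹ = (rtrans b).symm a := by
  simp [endpoint, follow_gen, step, Equiv.Perm.inv_def]

/-- The action of the structure group on `X`, as a homomorphism. -/
noncomputable def actionHom [Rack X] : StructureGroup X →* (Equiv.Perm X)ᵐᵒᵖ where
  toFun g := MulOpposite.op
    { toFun := fun a => endpoint a g
      invFun := fun a => endpoint a g⁻¹
      left_inv := fun a => by
        change endpoint (endpoint a g) g⁻¹ = a
        rw [← endpoint_mul, mul_inv_cancel, endpoint_one]
      right_inv := fun a => by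
        change endpoint (endpoint a g⁻¹) g = a
        rw [← endpoint_mul, inv_mul_cancel, endpoint_one] }
  map_one' := by
    apply MulOpposite.unop_injective
    ext1 a
    exact endpoint_one a
  map_mul' g h := by
    apply MulOpposite.unop_injective
    ext1 a
    exact endpoint_mul a g h

/-- In an abelian quandle, the actions of any two elements of the structure group commute. -/
theorem endpoint_comm [Quandle X] [IsAbelianQuandle X] (a : X) (g h : StructureGroup X) :
    endpoint a (g * h) = endpoint a (h * g) := by
  have key : ∀ (b : X) (g : StructureGroup X) (a : X), endpoint (a ◁ b) g = endpoint a g ◁ b := by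
    intro b g
    induction g using StructureGroup.induction with
    | h1 => intro a; simp [endpoint_one]
    | hgen g c ih =>
      intro a
      rw [endpoint_mul, endpoint_mul, ih, endpoint_gen, endpoint_gen,
        IsAbelianQuandle.rop_right_comm]
    | hinv g c ih =>
      intro a
      rw [endpoint_mul, endpoint_mul, ih, endpoint_inv_gen, endpoint_inv_gen,
        Equiv.symm_apply_eq, rtrans_apply, IsAbelianQuandle.rop_right_comm, ← rtrans_apply _ c,
        Equiv.apply_symm_apply]
  rw [endpoint_mul, endpoint_mul]
  induction h using StructureGroup.induction generalizing a with
  | h1 => simp [endpoint_one]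
  | hgen h b ih => simp only [endpoint_mul, endpoint_gen, key, ih]
  | hinv h b ih =>
    rw [endpoint_mul, endpoint_mul, endpoint_inv_gen, endpoint_inv_gen, Equiv.symm_apply_eq,
      rtrans_apply, ← key, ← rtrans_apply _ b, Equiv.apply_symm_apply, ih]

/-- In an abelian quandle, the commutator subgroup of the structure group acts trivially. -/
theorem endpoint_commutator [Quandle X] [IsAbelianQuandle X] (a : X) {g : StructureGroup X}
    (hg : g ∈ commutator (StructureGroup X)) : endpoint a g = a := by
  have hle : commutator (StructureGroup X) ≤ (actionHom (X := X)).ker := by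
    rw [commutator_def, Subgroup.commutator_le]
    intro g _ h _
    rw [MonoidHom.mem_ker, map_commutatorElement, commutatorElement_eq_one_iff_mul_comm,
      ← map_mul, ← map_mul]
    apply MulOpposite.unop_injective
    ext1 b
    exact endpoint_comm b g h
  exact congrArg (fun p => (MulOpposite.unop p) a) (MonoidHom.mem_ker.1 (hle hg))

/-- The torsion group `T_i` of an abelian quandle: the image of the commutator subgroup of the
structure group under the path map `p_a`, where `a` is any element of the orbit `O_i`.  It is a
subgroup of `H_2(X)`, considered inside `Q_2(X)` (see `torsionGroup_le`). -/
noncomputable def torsionGroup [Quandle X] [IsAbelianQuandle X] (a : X) : AddSubgroup (Q2 X) where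
  carrier := pathMap a '' (commutator (StructureGroup X) : Set (StructureGroup X))
  zero_mem' := ⟨1, one_mem _, pathMap_one a⟩
  add_mem' := by
    rintro _ _ ⟨g, hg, rfl⟩ ⟨h, hh, rfl⟩
    exact ⟨g * h, mul_mem hg hh, by rw [pathMap_mul, endpoint_commutator a hg]⟩
  neg_mem' := by
    rintro _ ⟨g, hg, rfl⟩
    refine ⟨g⁻¹, inv_mem hg, ?_⟩
    have h := pathMap_mul a g g⁻¹
    rw [mul_inv_cancel, pathMap_one, endpoint_commutator a hg] at h
    exact eq_neg_of_add_eq_zero_right h.symm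

/-- The differential `d_2` on `Q_2 = C_2 / B_2`. -/
noncomputable def boundaryQ2 (X : Type*) [Shelf X] : Q2 X →ₗ[ℤ] Chain X 1 :=
  Submodule.liftQ _ (boundary X 1) (LinearMap.range_le_ker_iff.2 (boundary_boundary X))

theorem boundaryQ2_pathMap [Rack X] (a : X) (g : StructureGroup X) :
    boundaryQ2 X (pathMap a g)
      = Finsupp.single ![endpoint a g] 1 - Finsupp.single ![a] 1 := by
  have hedge : ∀ a b : X, boundaryQ2 X (edge a b)
      = Finsupp.single ![a ◁ b] 1 - Finsupp.single ![a] 1 := fun a b => boundary_two a b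
  induction g using StructureGroup.induction with
  | h1 => simp [pathMap_one, endpoint_one]
  | hgen g b ih =>
    rw [pathMap_mul, endpoint_mul, map_add, ih, pathMap_gen, endpoint_gen, hedge]
    abel
  | hinv g b ih =>
    have h := pathMap_mul a (g * (StructureGroup.gen b)⁻¹) (StructureGroup.gen b)
    rw [inv_mul_cancel_right, pathMap_gen] at h
    have h' := congrArg (boundaryQ2 X) h
    rw [map_add, hedge, ih, ← endpoint_gen, ← endpoint_mul, inv_mul_cancel_right] at h'
    rw [← sub_eq_iff_eq_add] at h'
    rw [← h']
    abel

/-- The torsion groups lie in `H_2(X) ⊆ Q_2(X)`. -/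
theorem torsionGroup_le [Quandle X] [IsAbelianQuandle X] (a : X) :
    torsionGroup a ≤ (LinearMap.range (H2toQ2 X)).toAddSubgroup := by
  rintro _ ⟨g, hg, rfl⟩
  have h := boundaryQ2_pathMap a g
  rw [endpoint_commutator a hg, sub_self] at h
  obtain ⟨z, hz⟩ := Submodule.Quotient.mk_surjective _ (pathMap a g)
  rw [← hz] at h
  exact ⟨Submodule.Quotient.mk ⟨z, LinearMap.mem_ker.2 h⟩, hz⟩

end General

/-! ### Parameters of abelian quandles

Here `r = s + 1` is the number of orbits, and the (commutative) groups `G(M)` are written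
additively.  Indices of generators and of rows are numbered from `0`. -/

/-- A lower triangular matrix of parameters `m_{i,j}`, `j ≤ i`, of size `s`, with
`1 ≤ m_{i,i}` and `0 ≤ m_{j,i} < m_{i,i}` for `i < j`. -/
structure ParamMatrix (s : ℕ) where
  entry : Fin s → Fin s → ℕ
  one_le_diag : ∀ i, 1 ≤ entry i i
  entry_lt : ∀ i j, i < j → entry j i < entry i i
  entry_eq_zero : ∀ i j, i < j → entry i j = 0

/-- The abelian group `G(M)` with `s` generators and one relation for each row of `M`. -/
abbrev ParamMatrix.Group {s : ℕ} (M : ParamMatrix s) : Type :=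
  (Fin s → ℤ) ⧸ AddSubgroup.closure (Set.range fun i : Fin s => fun j : Fin s => (M.entry i j : ℤ))

/-- The elements `x_0, x_1, …, x_s` of `G(M)`: `x_0` is the neutral element, and
`x_1, …, x_s` are the generators. -/
def ParamMatrix.gen {s : ℕ} (M : ParamMatrix s) : Fin (s + 1) → M.Group :=
  Fin.cases 0 fun k => QuotientAddGroup.mk (Pi.single k 1)

theorem ParamMatrix.gen_zero {s : ℕ} (M : ParamMatrix s) : M.gen 0 = 0 := rfl

/-- The filtered-permutation quandle `Q(M^{(0)}, …, M^{(s)})`: the disjoint union of the groups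
`G(M^{(i)})`.  Its operation is `a^{(i)} ◁ b^{(j)} = a^{(i)} x_{j-i}^{(i)}`, where `j - i` is
taken modulo `s + 1`. -/
def FPQuandle {s : ℕ} (M : Fin (s + 1) → ParamMatrix s) : Type := Σ i, (M i).Group

instance {s : ℕ} (M : Fin (s + 1) → ParamMatrix s) : Quandle (FPQuandle M) where
  act b a := ⟨a.1, a.2 + (M a.1).gen (b.1 - a.1)⟩
  self_distrib := by
    rintro ⟨k, c⟩ ⟨j, b⟩ ⟨i, a⟩
    simp only [add_right_comm]
    rfl
  invAct b a := ⟨a.1, a.2 - (M a.1).gen (b.1 - a.1)⟩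
  left_inv b a := by
    simp only [add_sub_cancel_right]
    rfl
  right_inv b a := by
    simp only [sub_add_cancel]
    rfl
  fix := by
    rintro ⟨i, a⟩
    simp only [sub_self, ParamMatrix.gen_zero, add_zero]
    rfl

/-- The parameter group `G'` attached to parameters `M^{(0)}, …, M^{(s)}`: the quotient of the
product of the `G(M^{(i)})` by the elements `x^{(i)}_{j-i} x^{(j)}_{i-j}`, `i < j`. -/
abbrev ParameterGroup {s : ℕ} (M : Fin (s + 1) → ParamMatrix s) : Type :=
  (∀ i, (M i).Group) ⧸ AddSubgroup.closure {z : ∀ i, (M i).Group |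
    ∃ i j, i < j ∧ z = Pi.single i ((M i).gen (j - i)) + Pi.single j ((M j).gen (i - j))}

/-! ### The quandles `U_{m,n}` -/

/-- The set `U_{m,n} = {x_0, …, x_{m-1}, y_0, …, y_{n-1}}`, for `m, n ≥ 1`; the indices are
taken modulo `m` and modulo `n` respectively. -/
inductive U (m n : ℕ) : Type
  | x (i : ZMod m) : U m n
  | y (k : ZMod n) : U m n

/-- The operation of `U_{m,n}`: `x_i ◁ x_j = x_i`, `y_k ◁ y_l = y_k`, `x_i ◁ y_k = x_{i+1}`,
`y_k ◁ x_i = y_{k+1}`. -/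
def U.op {m n : ℕ} : U m n → U m n → U m n
  | .x i, .x _ => .x i
  | .x i, .y _ => .x (i + 1)
  | .y k, .x _ => .y (k + 1)
  | .y k, .y _ => .y k

/-- The inverses of the right translations of `U_{m,n}`. -/
def U.opInv {m n : ℕ} : U m n → U m n → U m n
  | .x i, .x _ => .x i
  | .x i, .y _ => .x (i - 1)
  | .y k, .x _ => .y (k - 1)
  | .y k, .y _ => .y k

instance (m n : ℕ) : Quandle (U m n) where
  act b a := U.op a b
  self_distrib := by
    rintro (i | i) (j | j) (k | k) <;> rfl
  invAct b a := U.opInv a b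
  left_inv := by
    rintro (i | i) (j | j) <;> simp [U.op, U.opInv]
  right_inv := by
    rintro (i | i) (j | j) <;> simp [U.op, U.opInv]
  fix := by
    rintro (i | i) <;> rfl

instance (m n : ℕ) : IsAbelianQuandle (U m n) where
  rop_right_comm := by
    rintro (i | i) (j | j) (k | k) <;> rfl

/-- The `1 × 1` parameter matrix with entry `m`. -/
def ParamMatrix.one (m : ℕ) (hm : 1 ≤ m) : ParamMatrix 1 where
  entry _ _ := m
  one_le_diag _ := hm
  entry_lt i j h := absurd h (by simp [Subsingleton.elim i j])
  entry_eq_zero i j h := absurd h (by simp [Subsingleton.elim i j])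

/-- The parameters `(m), (n)` of `U_{m,n}`. -/
def U.params (m n : ℕ) (hm : 1 ≤ m) (hn : 1 ≤ n) : Fin 2 → ParamMatrix 1 :=
  ![ParamMatrix.one m hm, ParamMatrix.one n hn]

/-- The isomorphism `G((m)) ≅ ℤ/m` that sends the generator `x_1` to `1`. -/
noncomputable def ParamMatrix.oneEquiv (m : ℕ) (hm : 1 ≤ m) :
    (ParamMatrix.one m hm).Group ≃+ ZMod m :=
  AddEquiv.ofBijective
    (QuotientAddGroup.lift _
      ((Int.castAddHom (ZMod m)).comp (Pi.evalAddMonoidHom (fun _ : Fin 1 => ℤ) 0))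
      (by
        rw [AddSubgroup.closure_le]
        rintro _ ⟨i, rfl⟩
        simp [ParamMatrix.one]))
    (by
      constructor
      · rw [injective_iff_map_eq_zero]
        intro z hz
        obtain ⟨f, rfl⟩ := QuotientAddGroup.mk_surjective z
        rw [QuotientAddGroup.eq_zero_iff]
        have h : ((f 0 : ℤ) : ZMod m) = 0 := hz
        obtain ⟨k, hk⟩ := (ZMod.intCast_zmod_eq_zero_iff_dvd _ _).1 h
        have hf : f = k • fun _ : Fin 1 => (m : ℤ) := by
          funext j
          rw [Subsingleton.elim j 0, hk]
          simp [mul_comm]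
        rw [hf]
        exact AddSubgroup.zsmul_mem _ (AddSubgroup.subset_closure (Set.mem_range_self 0)) k
      · intro c
        obtain ⟨k, rfl⟩ := ZMod.intCast_surjective c
        refine ⟨QuotientAddGroup.mk fun _ => k, ?_⟩
        rfl)

theorem ParamMatrix.oneEquiv_gen (m : ℕ) (hm : 1 ≤ m) :
    ParamMatrix.oneEquiv m hm ((ParamMatrix.one m hm).gen 1) = 1 := by
  change (((Pi.single 0 1 : Fin 1 → ℤ) 0 : ℤ) : ZMod m) = 1
  simp

/-- The identification of `U_{m,n}` with the filtered-permutation quandle with parameters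
`(m), (n)`; its orbits are taken in the order `{x_0, …, x_{m-1}}, {y_0, …, y_{n-1}}`. -/
noncomputable def U.equivFP (m n : ℕ) (hm : 1 ≤ m) (hn : 1 ≤ n) :
    U m n ≃ FPQuandle (U.params m n hm hn) where
  toFun
    | .x i => ⟨0, (ParamMatrix.oneEquiv m hm).symm i⟩
    | .y k => ⟨1, (ParamMatrix.oneEquiv n hn).symm k⟩
  invFun
    | ⟨0, a⟩ => .x (ParamMatrix.oneEquiv m hm a)
    | ⟨1, a⟩ => .y (ParamMatrix.oneEquiv n hn a)
  left_inv := by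
    rintro (i | k)
    · exact congrArg U.x ((ParamMatrix.oneEquiv m hm).apply_symm_apply i)
    · exact congrArg U.y ((ParamMatrix.oneEquiv n hn).apply_symm_apply k)
  right_inv := by
    rintro ⟨i, a⟩
    fin_cases i
    · exact congrArg (Sigma.mk (β := fun i => (U.params m n hm hn i).Group) 0)
        ((ParamMatrix.oneEquiv m hm).symm_apply_apply a)
    · exact congrArg (Sigma.mk (β := fun i => (U.params m n hm hn i).Group) 1)
        ((ParamMatrix.oneEquiv n hn).symm_apply_apply a)

/-- `U_{m,n}` does have the parameters `(m), (n)`. -/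
theorem U.equivFP_rop (m n : ℕ) (hm : 1 ≤ m) (hn : 1 ≤ n) (a b : U m n) :
    U.equivFP m n hm hn (a ◁ b) = U.equivFP m n hm hn a ◁ U.equivFP m n hm hn b := by
  rw [← Equiv.eq_symm_apply]
  rcases a with i | i <;> rcases b with j | j
  · change U.x i = U.x (ParamMatrix.oneEquiv m hm ((ParamMatrix.oneEquiv m hm).symm i + 0))
    simp
  · change U.x (i + 1) = U.x (ParamMatrix.oneEquiv m hm
      ((ParamMatrix.oneEquiv m hm).symm i + (ParamMatrix.one m hm).gen 1))
    rw [map_add, ParamMatrix.oneEquiv_gen, AddEquiv.apply_symm_apply]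
  · change U.y (i + 1) = U.y (ParamMatrix.oneEquiv n hn
      ((ParamMatrix.oneEquiv n hn).symm i + (ParamMatrix.one n hn).gen 1))
    rw [map_add, ParamMatrix.oneEquiv_gen, AddEquiv.apply_symm_apply]
  · change U.y i = U.y (ParamMatrix.oneEquiv n hn ((ParamMatrix.oneEquiv n hn).symm i + 0))
    simp

end QuandleHomology

/-! In the structure group, the element `g_{x_i}⁻¹ g_{x_{i+1}}` is the commutator of `g_{x_i}⁻¹` and
`g_{y_k}⁻¹`, and so is `g_{y_{k+1}}⁻¹ g_{y_k}`. The first form does not involve `k` and the second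
does not involve `i`, so there is a single element `twist`. The first form commutes with every
`g_x`, the second with every `g_y`; hence `twist` is central and generates the commutator subgroup
(`commutator_eq`). Going once around either orbit gives `twist ^ m = 1` and `twist ^ n = 1`, so its
order divides `gcd(m,n)`.

Write `τ_a` for its image under `p_a`; by centrality it depends only on the orbit of `a`. Raising
the label of an edge from `x_j` to `x_{j+1}` adds `τ_a`, and from `y_k` to `y_{k+1}` subtracts it.
So `Q_2` is generated by two loops `(x_0, x_0)`, `(y_0, y_0)`, the edges `(x_i, y_0)` and `(y_k,
x_0)`, and the two elements `τ`. Explicit homomorphisms `loopCoord`, `crossCoord`, `torsionCoord`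
out of `Q_2` show that there are no relations beyond `gcd(m,n) τ = 0`: `Q_2 ≅ ℤ² ⊕ (ℤ^m ⊕ ℤ^n) ⊕
(ℤ/gcd(m,n))²`. The torsion coordinate also shows that each `τ_a` has order exactly `gcd(m,n)`,
which gives the torsion groups and the injectivity of the path maps on commutators.

The differential only sees the cross coordinates, and it vanishes exactly when they are constant
along each orbit. This leaves one integer for each orbit besides the two loops, whence `ℤ⁴`. -/

namespace QuandleHomology

/-! ### Homomorphisms out of `Q_2` -/

section Q2

variable {X : Type*} [Shelf X] {A : Type*} [AddCommGroup A]

/-- A homomorphism out of `Q_2` is given by its values on edges. -/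
noncomputable def Q2.lift (f : X → X → A)
    (hf : ∀ a b c, f a b + f (a ◁ b) c = f a c + f (a ◁ c) (b ◁ c)) : Q2 X →ₗ[ℤ] A :=
  Submodule.liftQ _ (Finsupp.linearCombination ℤ fun v : Fin 2 → X => f (v 0) (v 1)) (by
    rw [LinearMap.range_le_ker_iff]
    apply Finsupp.lhom_ext'
    intro v
    apply LinearMap.ext_ring
    obtain ⟨a, b, c, rfl⟩ : ∃ a b c, v = ![a, b, c] :=
      ⟨v 0, v 1, v 2, by funext j; fin_cases j <;> rfl⟩
    change Finsupp.linearCombination ℤ _ (boundary X 2 (Finsupp.single ![a, b, c] 1)) = 0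
    rw [boundary_three]
    simp only [map_add, map_sub, Finsupp.linearCombination_single, one_smul, Matrix.cons_val_zero,
      Matrix.cons_val_one]
    -- The zero on the right is replaced by the difference of the two sides of the square relation.
    rw [← sub_eq_zero.2 (hf a b c)]
    abel)

theorem Q2.lift_edge (f : X → X → A)
    (hf : ∀ a b c, f a b + f (a ◁ b) c = f a c + f (a ◁ c) (b ◁ c)) (a b : X) :
    Q2.lift f hf (edge a b) = f a b := by
  change Finsupp.linearCombination ℤ _ (Finsupp.single ![a, b] 1) = _
  simp

theorem Q2.hom_ext {f g : Q2 X →ₗ[ℤ] A} (h : ∀ a b, f (edge a b) = g (edge a b)) : f = g := by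
  apply Submodule.linearMap_qext
  apply Finsupp.lhom_ext'
  intro v
  apply LinearMap.ext_ring
  obtain ⟨a, b, rfl⟩ : ∃ a b, v = ![a, b] :=
    ⟨v 0, v 1, by funext j; fin_cases j <;> rfl⟩
  exact h a b

theorem boundaryQ2_edge (a b : X) :
    boundaryQ2 X (edge a b) = Finsupp.single ![a ◁ b] 1 - Finsupp.single ![a] 1 :=
  boundary_two a b

theorem exists_H2toQ2_eq {q : Q2 X} (hq : boundaryQ2 X q = 0) : ∃ z, H2toQ2 X z = q := by
  obtain ⟨c, rfl⟩ := Submodule.Quotient.mk_surjective _ q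
  exact ⟨Submodule.Quotient.mk ⟨c, LinearMap.mem_ker.2 hq⟩, rfl⟩

theorem boundaryQ2_H2toQ2 (z : H2 X) : boundaryQ2 X (H2toQ2 X z) = 0 := by
  obtain ⟨c, rfl⟩ := Submodule.Quotient.mk_surjective _ z
  exact LinearMap.mem_ker.1 c.2

/-- `H_2` is isomorphic to `A` as soon as `A` maps onto the cycles in `Q_2` by a map with a
retraction defined on all of `Q_2`. -/
theorem nonempty_H2_equiv (S : A → Q2 X) (R : Q2 X →+ A) (hS : ∀ v, boundaryQ2 X (S v) = 0)
    (hRS : ∀ v, R (S v) = v) (hSR : ∀ q, boundaryQ2 X q = 0 → S (R q) = q) :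
    Nonempty (H2 X ≃+ A) := by
  refine ⟨AddEquiv.ofBijective (R.comp (H2toQ2 X).toAddMonoidHom) ⟨fun z w h => ?_, fun v => ?_⟩⟩
  · apply H2toQ2_injective X
    rw [← hSR _ (boundaryQ2_H2toQ2 z), ← hSR _ (boundaryQ2_H2toQ2 w)]
    exact congrArg S h
  · obtain ⟨z, hz⟩ := exists_H2toQ2_eq (hS v)
    exact ⟨z, (congrArg R hz).trans (hRS v)⟩

end Q2

/-! ### Commutator subgroups and generators -/

/-- The powers of a central element form a normal subgroup. Modulo it the generators commute, so the
quotient is abelian. -/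
theorem commutator_le_of_closure {G : Type*} [Group G] {S : Set G}
    (hS : Subgroup.closure S = ⊤) {z : G} (hz : z ∈ Subgroup.center G)
    (h : ∀ s ∈ S, ∀ t ∈ S, ∃ k : ℤ, s * t = t * s * z ^ k) :
    commutator G ≤ Subgroup.zpowers z := by
  have hzc : ∀ g : G, g * z = z * g := Subgroup.mem_center_iff.1 hz
  have hN : (Subgroup.zpowers z).Normal := by
    constructor
    rintro _ ⟨k, rfl⟩ g
    have : Commute g z := hzc g
    simp only [(this.zpow_right k).eq, mul_inv_cancel_right]
    exact ⟨k, rfl⟩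
  have hST : ∀ s ∈ S, ∀ t ∈ S, (QuotientGroup.mk' (Subgroup.zpowers z)) s *
      (QuotientGroup.mk' (Subgroup.zpowers z)) t = (QuotientGroup.mk' (Subgroup.zpowers z)) t *
      (QuotientGroup.mk' (Subgroup.zpowers z)) s := by
    intro s hs t ht
    obtain ⟨k, hk⟩ := h s hs t ht
    rw [← map_mul, hk, map_mul, map_mul, mul_eq_left]
    exact (QuotientGroup.eq_one_iff _).2 ⟨k, rfl⟩
  have hcomm : ∀ g h : G, (QuotientGroup.mk' (Subgroup.zpowers z)) g *
      (QuotientGroup.mk' (Subgroup.zpowers z)) h = (QuotientGroup.mk' (Subgroup.zpowers z)) h *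
      (QuotientGroup.mk' (Subgroup.zpowers z)) g := by
    intro g h
    have hg : g ∈ Subgroup.closure S := hS ▸ Subgroup.mem_top g
    have hh : h ∈ Subgroup.closure S := hS ▸ Subgroup.mem_top h
    induction hg, hh using Subgroup.closure_induction₂ with
    | mem s t hs ht => exact hST s hs t ht
    | one_left => simp
    | one_right => simp
    | mul_left a b c _ _ _ h1 h2 => rw [map_mul]; exact Commute.mul_left h1 h2
    | mul_right a b c _ _ _ h1 h2 => rw [map_mul]; exact Commute.mul_right h1 h2
    | inv_left a b _ _ h1 => rw [map_inv]; exact Commute.inv_left h1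
    | inv_right a b _ _ h1 => rw [map_inv]; exact Commute.inv_right h1
  rw [commutator_def, Subgroup.commutator_le]
  intro g _ h _
  rw [← QuotientGroup.eq_one_iff, ← QuotientGroup.mk'_apply, map_commutatorElement,
    commutatorElement_eq_one_iff_mul_comm]
  exact hcomm g h

/-! ### The structure group of `U_{m,n}` -/

theorem StructureGroup.gen_mul_gen {X : Type*} [Shelf X] (a b : X) :
    StructureGroup.gen a * StructureGroup.gen b
      = StructureGroup.gen b * StructureGroup.gen (a ◁ b) := by
  rw [← mul_inv_eq_one]
  exact PresentedGroup.one_of_mem (rels := Set.range fun p : X × X =>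
    FreeGroup.of p.1 * FreeGroup.of p.2 * (FreeGroup.of p.2 * FreeGroup.of (p.1 ◁ p.2))⁻¹)
    ⟨(a, b), rfl⟩

theorem StructureGroup.closure_range_gen {X : Type*} [Shelf X] :
    Subgroup.closure (Set.range (StructureGroup.gen (X := X))) = ⊤ :=
  PresentedGroup.closure_range_of _

namespace U

variable {m n : ℕ}

@[simp] theorem x_rop_x (i j : ZMod m) : (x i : U m n) ◁ x j = x i := rfl
@[simp] theorem x_rop_y (i : ZMod m) (k : ZMod n) : (x i : U m n) ◁ y k = x (i + 1) := rfl
@[simp] theorem y_rop_x (k : ZMod n) (i : ZMod m) : (y k : U m n) ◁ x i = y (k + 1) := rfl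
@[simp] theorem y_rop_y (k l : ZMod n) : (y k : U m n) ◁ y l = y k := rfl

open StructureGroup

variable (m n) in
/-- The generator `g_{x_0}⁻¹ g_{x_1}` of the commutator subgroup of the structure group. -/
def twist : StructureGroup (U m n) := (gen (x 0))⁻¹ * gen (x 1)

/-- Both sides equal `g_x⁻¹ g_y⁻¹ g_x g_y` with `x = x_i`, `y = y_k`. As `k` is absent on the left
and `i` on the right, the common value depends on neither. -/
theorem gen_x_inv_mul (i : ZMod m) (k : ZMod n) :
    (gen (x i : U m n))⁻¹ * gen (x (i + 1)) = (gen (y (k + 1)))⁻¹ * gen (y k) := by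
  have h1 := gen_mul_gen (x i : U m n) (y k)
  have h2 := gen_mul_gen (y k : U m n) (x i)
  rw [x_rop_y] at h1
  rw [y_rop_x] at h2
  rw [eq_inv_mul_iff_mul_eq.2 h1.symm, eq_inv_mul_iff_mul_eq.2 h2.symm]
  group

theorem gen_x_succ (i : ZMod m) : gen (x (i + 1) : U m n) = gen (x i) * twist m n := by
  rw [← inv_mul_eq_iff_eq_mul, gen_x_inv_mul i 0, ← gen_x_inv_mul 0 0, zero_add, twist]

theorem gen_y_succ (k : ZMod n) : gen (y (k + 1) : U m n) = gen (y k) * (twist m n)⁻¹ := by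
  rw [eq_mul_inv_iff_mul_eq, ← eq_inv_mul_iff_mul_eq, ← gen_x_inv_mul 0 k, zero_add, twist]

/-- The index is a natural number, not a residue, so that `i = m` closes the cycle and yields a
relation on `twist`. -/
theorem gen_x_natCast (i : ℕ) : gen (x (i : ZMod m) : U m n) = gen (x 0) * twist m n ^ i := by
  induction i with
  | zero => simp
  | succ i ih => rw [Nat.cast_succ, gen_x_succ, ih, mul_assoc, pow_succ]

theorem gen_y_natCast (k : ℕ) : gen (y (k : ZMod n) : U m n) = gen (y 0) * (twist m n)⁻¹ ^ k := by
  induction k with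
  | zero => simp
  | succ k ih => rw [Nat.cast_succ, gen_y_succ, ih, mul_assoc, pow_succ]

theorem twist_pow_gcd : twist m n ^ Nat.gcd m n = 1 := by
  have h1 := gen_x_natCast (n := n) m (m := m)
  have h2 := gen_y_natCast (n := n) n (m := m)
  rw [ZMod.natCast_self, left_eq_mul] at h1 h2
  rw [inv_pow, inv_eq_one] at h2
  exact orderOf_dvd_iff_pow_eq_one.1
    (Nat.dvd_gcd (orderOf_dvd_of_pow_eq_one h1) (orderOf_dvd_of_pow_eq_one h2))

theorem mem_center_of_commute_gen {X : Type*} [Rack X] {z : StructureGroup X}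
    (h : ∀ b, Commute (gen b) z) : z ∈ Subgroup.center (StructureGroup X) := by
  rw [Subgroup.mem_center_iff]
  intro g
  change Commute g z
  induction g using StructureGroup.induction with
  | h1 => exact Commute.one_left z
  | hgen g b ih => exact ih.mul_left (h b)
  | hinv g b ih => exact ih.mul_left (h b).inv_left

/-- Generators from the same orbit commute. Against `g_x` one uses `twist` as a word in the `g_x`,
against `g_y` its second form as a word in the `g_y`. -/
theorem twist_mem_center : twist m n ∈ Subgroup.center (StructureGroup (U m n)) := by
  apply mem_center_of_commute_gen
  rintro (i | k)
  · have h : ∀ j, Commute (gen (x i : U m n)) (gen (x j)) := fun j => gen_mul_gen _ _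
    exact (h 0).inv_right.mul_right (h 1)
  · have h : ∀ l, Commute (gen (y k : U m n)) (gen (y l)) := fun l => gen_mul_gen _ _
    have h1 := gen_x_inv_mul (0 : ZMod m) (0 : ZMod n)
    rw [zero_add, zero_add] at h1
    rw [twist, h1]
    exact (h 1).inv_right.mul_right (h 0)

open scoped commutatorElement in
variable (m n) in
theorem commutator_eq : commutator (StructureGroup (U m n)) = Subgroup.zpowers (twist m n) := by
  apply le_antisymm
  · apply commutator_le_of_closure closure_range_gen twist_mem_center
    rintro _ ⟨i | i, rfl⟩ _ ⟨k | k, rfl⟩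
    · exact ⟨0, by rw [zpow_zero, mul_one]; exact gen_mul_gen _ _⟩
    · exact ⟨1, by rw [gen_mul_gen, x_rop_y, gen_x_succ, mul_assoc, zpow_one]⟩
    · exact ⟨-1, by rw [gen_mul_gen, y_rop_x, gen_y_succ, mul_assoc, zpow_neg_one]⟩
    · exact ⟨0, by rw [zpow_zero, mul_one]; exact gen_mul_gen _ _⟩
  · rw [Subgroup.zpowers_le]
    have h := gen_mul_gen (x 0 : U m n) (y 0)
    rw [x_rop_y, zero_add] at h
    have h' : twist m n = ⁅(gen (x 0 : U m n))⁻¹, (gen (y 0 : U m n))⁻¹⁆ := by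
      rw [twist, eq_inv_mul_iff_mul_eq.2 h.symm, commutatorElement_def]
      group
    rw [h', commutator_def]
    exact Subgroup.commutator_mem_commutator (Subgroup.mem_top _) (Subgroup.mem_top _)

theorem twist_mem_commutator : twist m n ∈ commutator (StructureGroup (U m n)) :=
  commutator_eq m n ▸ Subgroup.mem_zpowers _

/-! ### The torsion elements of `Q_2` -/

/-- Commutators fix every vertex, so the cocycle `p_a` is a homomorphism on the commutator subgroup.
-/
theorem pathMap_zpow_twist (a : U m n) (k : ℤ) :
    pathMap a (twist m n ^ k) = k • pathMap a (twist m n) := by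
  let f : commutator (StructureGroup (U m n)) →* Multiplicative (Q2 (U m n)) :=
    { toFun := fun g => Multiplicative.ofAdd (pathMap a g)
      map_one' := by simp [pathMap_one]
      map_mul' := fun g h => by
        simp [pathMap_mul, endpoint_commutator a g.2] }
  have h := congrArg Multiplicative.toAdd (map_zpow f ⟨twist m n, twist_mem_commutator⟩ k)
  exact h

theorem gcd_nsmul_pathMap_twist (a : U m n) :
    (Nat.gcd m n : ℤ) • pathMap a (twist m n) = 0 := by
  rw [← pathMap_zpow_twist, zpow_natCast, twist_pow_gcd, pathMap_one]

/-- Expand `p_a` of `g * twist = twist * g` by the cocycle rule and cancel `p_a(g)`; `twist` returns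
to `a`. -/
theorem pathMap_endpoint_twist (a : U m n) (g : StructureGroup (U m n)) :
    pathMap (endpoint a g) (twist m n) = pathMap a (twist m n) := by
  have h := congrArg (pathMap a) (Subgroup.mem_center_iff.1 twist_mem_center g)
  rw [pathMap_mul, pathMap_mul, endpoint_commutator a twist_mem_commutator, add_comm] at h
  exact add_right_cancel h

theorem pathMap_gen_x (a : U m n) (i : ℕ) :
    edge a (x (i : ZMod m)) = edge a (x 0) + i • pathMap a (twist m n) := by
  rw [← pathMap_gen, gen_x_natCast, pathMap_mul, pathMap_gen, ← zpow_natCast, pathMap_zpow_twist,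
    pathMap_endpoint_twist, natCast_zsmul]

theorem pathMap_gen_y (a : U m n) (k : ℕ) :
    edge a (y (k : ZMod n)) = edge a (y 0) - k • pathMap a (twist m n) := by
  rw [← pathMap_gen, gen_y_natCast, pathMap_mul, pathMap_gen, inv_pow, ← zpow_natCast,
    ← zpow_neg, pathMap_zpow_twist, pathMap_endpoint_twist, neg_smul, natCast_zsmul,
    sub_eq_add_neg]

theorem pathMap_x_natCast_twist (i : ℕ) :
    pathMap (x (i : ZMod m) : U m n) (twist m n) = pathMap (x 0) (twist m n) := by
  induction i with
  | zero => simp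
  | succ i ih =>
    rw [← ih, Nat.cast_succ, ← pathMap_endpoint_twist (x (i : ZMod m)) (gen (y 0)), endpoint_gen, x_rop_y]

theorem pathMap_y_natCast_twist (k : ℕ) :
    pathMap (y (k : ZMod n) : U m n) (twist m n) = pathMap (y 0) (twist m n) := by
  induction k with
  | zero => simp
  | succ k ih =>
    rw [← ih, Nat.cast_succ, ← pathMap_endpoint_twist (y (k : ZMod n)) (gen (x 0)), endpoint_gen, y_rop_x]

/-- In the square spanned at `x_i` by `x_j` and `y_0`, the label `x_j` moves no vertex, so the two
`y_0`-edges coincide and cancel. -/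
theorem edge_x_x_succ (i j : ZMod m) :
    edge (x (i + 1) : U m n) (x (j + 1)) = edge (x i) (x j) := by
  have h := edge_square (x i : U m n) (x j) (y 0)
  simp only [x_rop_x, x_rop_y] at h
  rw [add_comm] at h
  exact (add_left_cancel h).symm

theorem edge_y_y_succ (i j : ZMod n) :
    edge (y (i + 1) : U m n) (y (j + 1)) = edge (y i) (y j) := by
  have h := edge_square (y i : U m n) (y j) (x 0)
  simp only [y_rop_x, y_rop_y] at h
  rw [add_comm] at h
  exact (add_left_cancel h).symm

theorem edge_x_x_natCast (i j : ℕ) :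
    edge (x (i : ZMod m) : U m n) (x (j : ZMod m))
      = edge (x 0) (x 0) + ((j : ℤ) - i) • pathMap (x 0) (twist m n) := by
  have h : ∀ i : ℕ, edge (x (i : ZMod m) : U m n) (x (i : ZMod m)) = edge (x 0) (x 0) := by
    intro i
    induction i with
    | zero => simp
    | succ i ih => rw [Nat.cast_succ, edge_x_x_succ, ih]
  rw [← h i, pathMap_gen_x _ i, pathMap_gen_x _ j, pathMap_x_natCast_twist, sub_smul,
    natCast_zsmul, natCast_zsmul]
  abel

theorem edge_y_y_natCast (i j : ℕ) :
    edge (y (i : ZMod n) : U m n) (y (j : ZMod n))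
      = edge (y 0) (y 0) - ((j : ℤ) - i) • pathMap (y 0) (twist m n) := by
  have h : ∀ i : ℕ, edge (y (i : ZMod n) : U m n) (y (i : ZMod n)) = edge (y 0) (y 0) := by
    intro i
    induction i with
    | zero => simp
    | succ i ih => rw [Nat.cast_succ, edge_y_y_succ, ih]
  rw [← h i, pathMap_gen_y _ i, pathMap_gen_y _ j, pathMap_y_natCast_twist, sub_smul,
    natCast_zsmul, natCast_zsmul]
  abel

/-! ### Coordinates on `Q_2` -/

variable (m n) in
/-- Counts the edges inside each orbit. -/
noncomputable def loopCoord : Q2 (U m n) →ₗ[ℤ] ℤ × ℤ :=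
  Q2.lift (fun
    | x _, x _ => (1, 0)
    | y _, y _ => (0, 1)
    | _, _ => 0) (by
    rintro (i | i) (j | j) (k | k) <;> simp)

variable (m n) in
/-- Counts the edges between distinct vertices, by their source. -/
noncomputable def crossCoord : Q2 (U m n) →ₗ[ℤ] (ZMod m → ℤ) × (ZMod n → ℤ) :=
  Q2.lift (fun
    | x i, y _ => (Pi.single i 1, 0)
    | y k, x _ => (0, Pi.single k 1)
    | _, _ => 0) (by
    rintro (i | i) (j | j) (k | k) <;> simp [add_comm])

variable (m n) in
/-- The torsion coordinates: they detect the images of `twist` under the path maps. -/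
noncomputable def torsionCoord : Q2 (U m n) →ₗ[ℤ] ZMod (Nat.gcd m n) × ZMod (Nat.gcd m n) :=
  Q2.lift (fun
    -- An `x`-label counts positively and a `y`-label negatively, as for powers of `twist`. Inside
    -- an orbit the label is measured relative to the source, since shifting both leaves the edge
    -- unchanged. Reduction modulo the gcd puts both kinds of index in one group.
    | x i, x j => (ZMod.castHom (Nat.gcd_dvd_left m n) _ (j - i), 0)
    | x _, y l => (-(ZMod.castHom (Nat.gcd_dvd_right m n) _ l), 0)
    | y k, y l => (0, -(ZMod.castHom (Nat.gcd_dvd_right m n) _ (l - k)))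
    | y _, x j => (0, ZMod.castHom (Nat.gcd_dvd_left m n) _ j)) (by
    rintro (i | i) (j | j) (k | k) <;>
      simp only [x_rop_x, x_rop_y, y_rop_x, y_rop_y, map_add, map_sub, map_one, Prod.mk_add_mk,
        Prod.mk.injEq] <;> constructor <;> first | trivial | abel)

@[simp] theorem loopCoord_edge_x_x (i j : ZMod m) :
    loopCoord m n (edge (x i) (x j)) = (1, 0) := Q2.lift_edge _ _ _ _
@[simp] theorem loopCoord_edge_x_y (i : ZMod m) (l : ZMod n) :
    loopCoord m n (edge (x i) (y l)) = 0 := Q2.lift_edge _ _ _ _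
@[simp] theorem loopCoord_edge_y_x (k : ZMod n) (j : ZMod m) :
    loopCoord m n (edge (y k) (x j)) = 0 := Q2.lift_edge _ _ _ _
@[simp] theorem loopCoord_edge_y_y (k l : ZMod n) :
    loopCoord m n (edge (y k) (y l)) = (0, 1) := Q2.lift_edge _ _ _ _

@[simp] theorem crossCoord_edge_x_x (i j : ZMod m) :
    crossCoord m n (edge (x i) (x j)) = 0 := Q2.lift_edge _ _ _ _
@[simp] theorem crossCoord_edge_x_y (i : ZMod m) (l : ZMod n) :
    crossCoord m n (edge (x i) (y l)) = (Pi.single i 1, 0) := Q2.lift_edge _ _ _ _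
@[simp] theorem crossCoord_edge_y_x (k : ZMod n) (j : ZMod m) :
    crossCoord m n (edge (y k) (x j)) = (0, Pi.single k 1) := Q2.lift_edge _ _ _ _
@[simp] theorem crossCoord_edge_y_y (k l : ZMod n) :
    crossCoord m n (edge (y k) (y l)) = 0 := Q2.lift_edge _ _ _ _

@[simp] theorem torsionCoord_edge_x_x (i j : ZMod m) :
    torsionCoord m n (edge (x i) (x j))
      = (ZMod.castHom (Nat.gcd_dvd_left m n) _ (j - i), 0) := Q2.lift_edge _ _ _ _
@[simp] theorem torsionCoord_edge_x_y (i : ZMod m) (l : ZMod n) :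
    torsionCoord m n (edge (x i) (y l))
      = (-(ZMod.castHom (Nat.gcd_dvd_right m n) _ l), 0) := Q2.lift_edge _ _ _ _
@[simp] theorem torsionCoord_edge_y_x (k : ZMod n) (j : ZMod m) :
    torsionCoord m n (edge (y k) (x j))
      = (0, ZMod.castHom (Nat.gcd_dvd_left m n) _ j) := Q2.lift_edge _ _ _ _
@[simp] theorem torsionCoord_edge_y_y (k l : ZMod n) :
    torsionCoord m n (edge (y k) (y l))
      = (0, -(ZMod.castHom (Nat.gcd_dvd_right m n) _ (l - k))) := Q2.lift_edge _ _ _ _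

theorem pathMap_twist (a : U m n) :
    pathMap a (twist m n) = edge a (x 1) - edge a (x 0) := by
  have h := pathMap_gen_x a 1
  rw [Nat.cast_one, one_smul] at h
  rw [h, add_sub_cancel_left]

@[simp] theorem loopCoord_pathMap_twist (a : U m n) :
    loopCoord m n (pathMap a (twist m n)) = 0 := by
  rcases a with i | i <;> simp [pathMap_twist]

@[simp] theorem crossCoord_pathMap_twist (a : U m n) :
    crossCoord m n (pathMap a (twist m n)) = 0 := by
  rcases a with i | i <;> simp [pathMap_twist]

@[simp] theorem torsionCoord_pathMap_x_twist (i : ZMod m) :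
    torsionCoord m n (pathMap (x i) (twist m n)) = (1, 0) := by
  rw [pathMap_twist, map_sub, torsionCoord_edge_x_x, torsionCoord_edge_x_x, map_sub, map_sub]
  simp only [map_one, map_zero, Prod.mk_sub_mk, sub_zero]
  simp

@[simp] theorem torsionCoord_pathMap_y_twist (k : ZMod n) :
    torsionCoord m n (pathMap (y k) (twist m n)) = (0, 1) := by
  rw [pathMap_twist, map_sub, torsionCoord_edge_y_x, torsionCoord_edge_y_x]
  simp only [map_one, map_zero, Prod.mk_sub_mk, sub_zero]

@[simp] theorem boundaryQ2_pathMap_twist (a : U m n) :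
    boundaryQ2 _ (pathMap a (twist m n)) = 0 := by
  rw [boundaryQ2_pathMap, endpoint_commutator a twist_mem_commutator, sub_self]

/-- The edges entering `x_{i+1}` from `x_i` and those leaving it for `x_{i+2}` are the cross edges
counted here; edges inside an orbit have zero boundary. -/
theorem boundaryQ2_apply_x (q : Q2 (U m n)) (i : ZMod m) :
    boundaryQ2 _ q ![x (i + 1)] = (crossCoord m n q).1 i - (crossCoord m n q).1 (i + 1) := by
  have h : Finsupp.lapply (R := ℤ) ![x (i + 1)] ∘ₗ boundaryQ2 (U m n)
      = (LinearMap.proj (R := ℤ) (φ := fun _ : ZMod m => ℤ) i - LinearMap.proj (i + 1)) ∘ₗ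
        LinearMap.fst ℤ _ _ ∘ₗ crossCoord m n := by
    classical
    apply Q2.hom_ext
    rintro (j | j) (k | k) <;>
      simp [boundaryQ2_edge, Finsupp.single_apply, Pi.single_apply, eq_comm]
  exact LinearMap.congr_fun h q

theorem boundaryQ2_apply_y (q : Q2 (U m n)) (k : ZMod n) :
    boundaryQ2 _ q ![y (k + 1)] = (crossCoord m n q).2 k - (crossCoord m n q).2 (k + 1) := by
  have h : Finsupp.lapply (R := ℤ) ![y (k + 1)] ∘ₗ boundaryQ2 (U m n)
      = (LinearMap.proj (R := ℤ) (φ := fun _ : ZMod n => ℤ) k - LinearMap.proj (k + 1)) ∘ₗ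
        LinearMap.snd ℤ _ _ ∘ₗ crossCoord m n := by
    classical
    apply Q2.hom_ext
    rintro (j | j) (l | l) <;>
      simp [boundaryQ2_edge, Finsupp.single_apply, Pi.single_apply, eq_comm]
  exact LinearMap.congr_fun h q

/-- A function on `ℤ/m` that takes equal values on neighbours is constant. -/
theorem eq_const_of_add_one {m : ℕ} [NeZero m] {f : ZMod m → ℤ} (h : ∀ i, f i = f (i + 1)) :
    f = fun _ => f 0 := by
  have h' : ∀ i : ℕ, f i = f 0 := by
    intro i
    induction i with
    | zero => simp
    | succ i ih => rw [Nat.cast_succ, ← h, ih]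
  funext i
  rw [← h' i.val, ZMod.natCast_zmod_val]

/-- The homomorphism from `ℤ/gcd(m,n)` that sends `1` to the image of `twist` under `p_a`. -/
noncomputable def torsionHom (a : U m n) : ZMod (Nat.gcd m n) →+ Q2 (U m n) :=
  ZMod.lift _ ⟨zmultiplesHom _ (pathMap a (twist m n)), gcd_nsmul_pathMap_twist a⟩

@[simp] theorem torsionHom_intCast (a : U m n) (k : ℤ) :
    torsionHom a k = k • pathMap a (twist m n) := ZMod.lift_coe _ _ _

theorem map_torsionHom {A : Type*} [AddCommGroup A] (f : Q2 (U m n) →ₗ[ℤ] A) (a : U m n)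
    (k : ZMod (Nat.gcd m n)) : ∃ l : ℤ, (l : ZMod (Nat.gcd m n)) = k ∧
      f (torsionHom a k) = l • f (pathMap a (twist m n)) := by
  obtain ⟨l, rfl⟩ := ZMod.intCast_surjective k
  exact ⟨l, rfl, by rw [torsionHom_intCast, map_smul]⟩

@[simp] theorem loopCoord_torsionHom (a : U m n) (k : ZMod (Nat.gcd m n)) :
    loopCoord m n (torsionHom a k) = 0 := by
  obtain ⟨l, -, h⟩ := map_torsionHom (loopCoord m n) a k
  rw [h, loopCoord_pathMap_twist, smul_zero]

@[simp] theorem crossCoord_torsionHom (a : U m n) (k : ZMod (Nat.gcd m n)) :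
    crossCoord m n (torsionHom a k) = 0 := by
  obtain ⟨l, -, h⟩ := map_torsionHom (crossCoord m n) a k
  rw [h, crossCoord_pathMap_twist, smul_zero]

@[simp] theorem boundaryQ2_torsionHom (a : U m n) (k : ZMod (Nat.gcd m n)) :
    boundaryQ2 _ (torsionHom a k) = 0 := by
  obtain ⟨l, -, h⟩ := map_torsionHom (boundaryQ2 _) a k
  rw [h, boundaryQ2_pathMap_twist, smul_zero]

@[simp] theorem torsionCoord_torsionHom_x (i : ZMod m) (k : ZMod (Nat.gcd m n)) :
    torsionCoord m n (torsionHom (x i) k) = (k, 0) := by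
  obtain ⟨l, rfl, h⟩ := map_torsionHom (torsionCoord m n) (x i) k
  rw [h, torsionCoord_pathMap_x_twist]
  simp

@[simp] theorem torsionCoord_torsionHom_y (i : ZMod n) (k : ZMod (Nat.gcd m n)) :
    torsionCoord m n (torsionHom (y i) k) = (0, k) := by
  obtain ⟨l, rfl, h⟩ := map_torsionHom (torsionCoord m n) (y i) k
  rw [h, torsionCoord_pathMap_y_twist]
  simp

/-- One component of `torsionCoord`, chosen by the orbit of `a`, is a left inverse. This is the
lower bound on the order of `twist`. -/
theorem torsionHom_injective (a : U m n) : Function.Injective (torsionHom a) := by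
  intro k l h
  have h' := congrArg (torsionCoord m n) h
  rcases a with i | i
  · simpa using h'
  · simpa using h'

theorem mem_torsionGroup_iff {a : U m n} {q : Q2 (U m n)} :
    q ∈ torsionGroup a ↔ q ∈ (torsionHom a).range := by
  change q ∈ pathMap a '' _ ↔ _
  rw [commutator_eq]
  constructor
  · rintro ⟨_, ⟨k, rfl⟩, rfl⟩
    exact ⟨k, by rw [torsionHom_intCast]; exact (pathMap_zpow_twist a k).symm⟩
  · rintro ⟨k, rfl⟩
    obtain ⟨l, rfl⟩ := ZMod.intCast_surjective k
    exact ⟨_, ⟨l, rfl⟩, by rw [torsionHom_intCast]; exact pathMap_zpow_twist a l⟩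

/-- The torsion groups of `U_{m,n}` are cyclic of order `gcd(m,n)`. -/
noncomputable def torsionGroupEquiv (a : U m n) : torsionGroup a ≃+ ZMod (Nat.gcd m n) :=
  (AddEquiv.addSubgroupCongr (AddSubgroup.ext fun _ => mem_torsionGroup_iff)).trans
    (AddMonoidHom.ofInjective (torsionHom_injective a)).symm

/-- Equal images force the exponents to agree modulo `gcd(m,n)`, and `twist ^ gcd(m,n)` is already
trivial in the structure group. -/
theorem pathMap_injOn_commutator (a : U m n) :
    Set.InjOn (pathMap a) (commutator (StructureGroup (U m n)) : Set (StructureGroup (U m n))) := by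
  rw [commutator_eq]
  rintro _ ⟨k, rfl⟩ _ ⟨l, rfl⟩ h
  change twist m n ^ k = twist m n ^ l
  have h' : pathMap a (twist m n ^ k) = pathMap a (twist m n ^ l) := h
  rw [pathMap_zpow_twist, pathMap_zpow_twist, ← torsionHom_intCast, ← torsionHom_intCast] at h'
  have h2 := torsionHom_injective a h'
  rw [ZMod.intCast_eq_intCast_iff_dvd_sub] at h2
  obtain ⟨c, hc⟩ := h2
  rw [eq_add_of_sub_eq' hc, zpow_add, zpow_mul, zpow_natCast, twist_pow_gcd, one_zpow, mul_one]

/-! ### The second homology group -/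

variable (m n) in
/-- All the coordinates of an element of `Q_2`. -/
noncomputable def coord : Q2 (U m n) →ₗ[ℤ] (ℤ × ℤ) × ((ZMod m → ℤ) × (ZMod n → ℤ)) ×
    (ZMod (Nat.gcd m n) × ZMod (Nat.gcd m n)) :=
  (loopCoord m n).prod ((crossCoord m n).prod (torsionCoord m n))

theorem coord_apply (q : Q2 (U m n)) :
    coord m n q = (loopCoord m n q, crossCoord m n q, torsionCoord m n q) := rfl

section Homology

variable [NeZero m] [NeZero n]

variable (m n) in
/-- The element of `Q_2` with given coordinates. -/
noncomputable def ofCoord : (ℤ × ℤ) × ((ZMod m → ℤ) × (ZMod n → ℤ)) ×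
    (ZMod (Nat.gcd m n) × ZMod (Nat.gcd m n)) →+ Q2 (U m n) where
  toFun v := v.1.1 • edge (x 0) (x 0) + v.1.2 • edge (y 0) (y 0)
    + ∑ i, v.2.1.1 i • edge (x i) (y 0) + ∑ k, v.2.1.2 k • edge (y k) (x 0)
    + torsionHom (x 0) v.2.2.1 + torsionHom (y 0) v.2.2.2
  map_zero' := by simp
  map_add' v w := by
    simp only [Prod.fst_add, Prod.snd_add, Pi.add_apply, add_smul, Finset.sum_add_distrib, map_add]
    abel

theorem ofCoord_apply (v : (ℤ × ℤ) × ((ZMod m → ℤ) × (ZMod n → ℤ)) ×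
    (ZMod (Nat.gcd m n) × ZMod (Nat.gcd m n))) :
    ofCoord m n v = v.1.1 • edge (x 0) (x 0) + v.1.2 • edge (y 0) (y 0)
    + ∑ i, v.2.1.1 i • edge (x i) (y 0) + ∑ k, v.2.1.2 k • edge (y k) (x 0)
    + torsionHom (x 0) v.2.2.1 + torsionHom (y 0) v.2.2.2 := rfl

/-- It suffices to check edges, where the claim is the normal form of each of the four kinds of
edge. -/
theorem ofCoord_coord (q : Q2 (U m n)) : ofCoord m n (coord m n q) = q := by
  have h : (ofCoord m n).toIntLinearMap ∘ₗ coord m n = LinearMap.id := by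
    apply Q2.hom_ext
    rintro (i | i) (j | j) <;>
      change ofCoord m n (coord m n _) = edge _ _ <;>
      rw [coord_apply, ofCoord_apply] <;>
      -- Residues are replaced by natural representatives, for which the normal forms are stated.
      rw [← ZMod.natCast_zmod_val i, ← ZMod.natCast_zmod_val j]
    · rw [edge_x_x_natCast, ← torsionHom_intCast]
      simp
    · rw [pathMap_gen_y, pathMap_x_natCast_twist, ← natCast_zsmul, ← torsionHom_intCast]
      simp [Pi.single_apply, sub_eq_add_neg]
    · rw [pathMap_gen_x, pathMap_y_natCast_twist, ← natCast_zsmul, ← torsionHom_intCast]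
      simp [Pi.single_apply]
    · rw [edge_y_y_natCast, ← torsionHom_intCast]
      simp [sub_eq_add_neg]
  exact LinearMap.congr_fun h q

theorem coord_ofCoord (v) : coord m n (ofCoord m n v) = v := by
  obtain ⟨⟨a, b⟩, ⟨f, g⟩, ⟨s, t⟩⟩ := v
  rw [coord_apply, ofCoord_apply]
  refine Prod.ext ?_ (Prod.ext ?_ ?_)
  · simp
  · simp [Prod.smul_mk, ← Pi.single_smul, Prod.ext_iff, Prod.fst_sum, Prod.snd_sum,
      Finset.univ_sum_single]
  · simp

/-- With constant coefficients the cross edges add up to full turns around the orbits. Their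
boundary vanishes because translation by `1` permutes the vertices. -/
theorem boundaryQ2_ofCoord_const (a b c d : ℤ) (s t : ZMod (Nat.gcd m n)) :
    boundaryQ2 _ (ofCoord m n ((a, b), (fun _ => c, fun _ => d), (s, t))) = 0 := by
  have hx := Equiv.sum_comp (Equiv.addRight (1 : ZMod m))
    fun i => Finsupp.single ![(x i : U m n)] (1 : ℤ)
  have hy := Equiv.sum_comp (Equiv.addRight (1 : ZMod n))
    fun k => Finsupp.single ![(y k : U m n)] (1 : ℤ)
  simp only [Equiv.coe_addRight] at hx hy
  rw [ofCoord_apply]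
  simp [boundaryQ2_edge, ← Finset.smul_sum, hx, hy]

theorem crossCoord_eq_const {q : Q2 (U m n)} (hq : boundaryQ2 _ q = 0) :
    crossCoord m n q = (fun _ => (crossCoord m n q).1 0, fun _ => (crossCoord m n q).2 0) := by
  refine Prod.ext (eq_const_of_add_one fun i => ?_) (eq_const_of_add_one fun k => ?_)
  · have h := boundaryQ2_apply_x q i
    rw [hq] at h
    exact sub_eq_zero.1 h.symm
  · have h := boundaryQ2_apply_y q k
    rw [hq] at h
    exact sub_eq_zero.1 h.symm

-- On a cycle each cross coordinate is constant, so its value at `0` loses nothing; together with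
-- the loop and torsion coordinates it gives the retraction.
variable (m n) in
theorem nonempty_H2_equiv :
    Nonempty (H2 (U m n) ≃+ (Fin 4 → ℤ) × (Fin 2 → ZMod (Nat.gcd m n))) := by
  refine QuandleHomology.nonempty_H2_equiv
    (fun v => ofCoord m n ((v.1 0, v.1 1), (fun _ => v.1 2, fun _ => v.1 3), (v.2 0, v.2 1)))
    { toFun := fun q => (![(loopCoord m n q).1, (loopCoord m n q).2, (crossCoord m n q).1 0,
        (crossCoord m n q).2 0], ![(torsionCoord m n q).1, (torsionCoord m n q).2])
      map_zero' := by
        refine Prod.ext ?_ ?_ <;> funext i <;> fin_cases i <;> simp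
      map_add' := fun q r => by
        refine Prod.ext ?_ ?_ <;> funext i <;> fin_cases i <;> simp }
    (fun v => boundaryQ2_ofCoord_const _ _ _ _ _ _) (fun v => ?_) (fun q hq => ?_)
  · have h := coord_ofCoord (m := m) (n := n)
      ((v.1 0, v.1 1), (fun _ => v.1 2, fun _ => v.1 3), (v.2 0, v.2 1))
    have h1 := congrArg Prod.fst h
    have h2 := congrArg (fun w => w.2.1) h
    have h3 := congrArg (fun w => w.2.2) h
    simp only [coord_apply] at h1 h2 h3
    refine Prod.ext ?_ ?_ <;> funext i <;> fin_cases i <;> simp [h1, h2, h3]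
  · have h := ofCoord_coord q
    rw [coord_apply, crossCoord_eq_const hq] at h
    exact h

end Homology

/-! ### The parameter group -/

-- The difference of the two reductions maps `ℤ/m × ℤ/n` onto `ℤ/gcd(m,n)`; by Bézout its kernel is
-- generated by `(1, 1)`, the image of `xy`.
variable (m n) in
theorem nonempty_parameterGroup_equiv (hm : 1 ≤ m) (hn : 1 ≤ n) :
    Nonempty (ParameterGroup (U.params m n hm hn) ≃+ ZMod (Nat.gcd m n)) := by
  let π₀ : (∀ i, (U.params m n hm hn i).Group) →+ ZMod m :=
    (ParamMatrix.oneEquiv m hm).toAddMonoidHom.comp (Pi.evalAddMonoidHom _ 0)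
  let π₁ : (∀ i, (U.params m n hm hn i).Group) →+ ZMod n :=
    (ParamMatrix.oneEquiv n hn).toAddMonoidHom.comp (Pi.evalAddMonoidHom _ 1)
  let φ : (∀ i, (U.params m n hm hn i).Group) →+ ZMod (Nat.gcd m n) :=
    (ZMod.castHom (Nat.gcd_dvd_left m n) _).toAddMonoidHom.comp π₀
      - (ZMod.castHom (Nat.gcd_dvd_right m n) _).toAddMonoidHom.comp π₁
  have hφ_apply : ∀ v, φ v = ZMod.castHom (Nat.gcd_dvd_left m n) (ZMod (Nat.gcd m n)) (π₀ v)
      - ZMod.castHom (Nat.gcd_dvd_right m n) (ZMod (Nat.gcd m n)) (π₁ v) := fun _ => rfl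
  have hφ : AddSubgroup.closure {z : ∀ i, (U.params m n hm hn i).Group | ∃ i j, i < j ∧
      z = Pi.single i ((U.params m n hm hn i).gen (j - i))
        + Pi.single j ((U.params m n hm hn j).gen (i - j))} = φ.ker := by
    set z₀ : ∀ i, (U.params m n hm hn i).Group :=
      Pi.single 0 ((U.params m n hm hn 0).gen (1 - 0))
        + Pi.single 1 ((U.params m n hm hn 1).gen (0 - 1)) with hz₀
    have h0 : π₀ z₀ = 1 := by
      have : z₀ 0 = (U.params m n hm hn 0).gen 1 := by simp [hz₀]
      change ParamMatrix.oneEquiv m hm (z₀ 0) = 1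
      rw [this]
      exact ParamMatrix.oneEquiv_gen m hm
    have h1 : π₁ z₀ = 1 := by
      have : z₀ 1 = (U.params m n hm hn 1).gen 1 := by
        simp only [hz₀, Pi.add_apply, Pi.single_eq_same, Pi.single_eq_of_ne one_ne_zero, zero_add]
        -- In `Fin 2` one has `0 - 1 = 1`, so this component too is the generator and not the
        -- neutral element.
        rfl
      change ParamMatrix.oneEquiv n hn (z₀ 1) = 1
      rw [this]
      exact ParamMatrix.oneEquiv_gen n hn
    have hinj : ∀ v w, π₀ v = π₀ w → π₁ v = π₁ w → v = w := by
      intro v w hv hw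
      funext i
      fin_cases i
      · exact (ParamMatrix.oneEquiv m hm).injective hv
      · exact (ParamMatrix.oneEquiv n hn).injective hw
    apply le_antisymm
    · rw [AddSubgroup.closure_le]
      rintro _ ⟨i, j, hij, rfl⟩
      obtain ⟨rfl, rfl⟩ : i = 0 ∧ j = 1 := by omega
      change φ z₀ = 0
      rw [hφ_apply, h0, h1, map_one, map_one, sub_self]
    · intro v hv
      have hv' : φ v = 0 := hv
      obtain ⟨s, hs⟩ := ZMod.intCast_surjective (π₀ v)
      obtain ⟨t, ht⟩ := ZMod.intCast_surjective (π₁ v)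
      rw [hφ_apply, ← hs, ← ht, map_intCast, map_intCast, sub_eq_zero,
        ZMod.intCast_eq_intCast_iff_dvd_sub] at hv'
      obtain ⟨c, hc⟩ := hv'
      -- The multiplier must be `s` modulo `m` and `t` modulo `n`. Since `t - s = gcd * c`, the
      -- Bézout identity also writes it as `t - n * (gcdB * c)`.
      have key : v = (s + m * (Nat.gcdA m n * c)) • z₀ := by
        apply hinj
        · rw [map_zsmul, h0, ← hs]
          simp
        · have : s + m * (Nat.gcdA m n * c) = t - n * (Nat.gcdB m n * c) := by
            rw [Nat.gcd_eq_gcd_ab] at hc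
            linear_combination -hc
          rw [map_zsmul, h1, ← ht, this]
          simp
      rw [key]
      refine AddSubgroup.zsmul_mem _ (AddSubgroup.subset_closure ?_) _
      exact ⟨0, 1, by decide, rfl⟩
  have hsurj : Function.Surjective φ := by
    intro c
    obtain ⟨k, rfl⟩ := ZMod.intCast_surjective c
    refine ⟨Pi.single 0 (k • (U.params m n hm hn 0).gen 1), ?_⟩
    have h0 : π₀ (Pi.single 0 (k • (U.params m n hm hn 0).gen 1)) = k := by
      change ParamMatrix.oneEquiv m hm (k • (ParamMatrix.one m hm).gen 1) = k
      rw [map_zsmul, ParamMatrix.oneEquiv_gen]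
      simp
    have h1 : π₁ (Pi.single 0 (k • (U.params m n hm hn 0).gen 1)) = 0 :=
      map_zero (ParamMatrix.oneEquiv n hn)
    rw [hφ_apply, h0, h1, map_zero, sub_zero, map_intCast]
  exact ⟨(QuotientAddGroup.quotientAddEquivOfEq hφ).trans
    (QuotientAddGroup.quotientKerEquivOfSurjective φ hsurj)⟩

end U
end QuandleHomology

/-! ### Homology, parameter group and torsion groups of `U_{m,n}` combined. -/

theorem mainTheorem8 (m n : ℕ) (hm : 1 ≤ m) (hn : 1 ≤ n) :
    Nonempty (QuandleHomology.H2 (QuandleHomology.U m n) ≃+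
      (Fin 4 → ℤ) × (Fin 2 → ZMod (Nat.gcd m n))) ∧
    Nonempty (QuandleHomology.ParameterGroup (QuandleHomology.U.params m n hm hn) ≃+
      ZMod (Nat.gcd m n)) ∧
    (∀ a : QuandleHomology.U m n,
      Set.InjOn (QuandleHomology.pathMap a)
        (commutator (QuandleHomology.StructureGroup (QuandleHomology.U m n)) :
          Set (QuandleHomology.StructureGroup (QuandleHomology.U m n))) ∧
      Nonempty (QuandleHomology.torsionGroup a ≃+
        QuandleHomology.ParameterGroup (QuandleHomology.U.params m n hm hn))) := by
  have : NeZero m := ⟨by omega⟩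
  have : NeZero n := ⟨by omega⟩
  obtain ⟨e⟩ := QuandleHomology.U.nonempty_parameterGroup_equiv m n hm hn
  exact ⟨QuandleHomology.U.nonempty_H2_equiv m n, ⟨e⟩, fun a =>
    ⟨QuandleHomology.U.pathMap_injOn_commutator a,
      ⟨(QuandleHomology.U.torsionGroupEquiv a).trans e.symm⟩⟩⟩
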